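/- Consider the fully-adaptive source-oblivious broadcast model. Every vertex $v$ of a graph $G$ has a fixed list $\ell_v$ of distinct neighbors, the same for all sources. Initially only the source is informed, and at each round every informed vertex $v$ calls (and thereby informs) the first vertex of $\ell_v$ that was not informed at the end of the previous round, if there is one. The broadcast time of $G$ is the minimum, over all collections of lists, of the maximum, over all sources, of the number of rounds until all vertices are informed. An $n$-vertex graph is a broadcast graph if its broadcast time is $\lceil\log_2 n\rceil$. Let $L(n)$ be the number of consecutive leading $1$s in the binary representation of $n-1$. **Theorem.** (1) There is a constant $C$ such that for every $n\ge 1$ there is a broadcast graph with $n$ vertices and at most $C\cdot n\cdot L(n)$ edges. (2) Every $n\ge 1$ that is not a power of $2$ can be written as $n=2^m-2^k-r$ with $0\le k\le m-2$ and $0\le r\le 2^k-1$, and for every such representation $L(n)=m-k-1$ and the following holds. Take the disjoint union of binomial trees $T_{m-1},\dots,T_k$ of dimensions $m-1,\dots,k$, with roots $v_{m-1},\dots,v_k$. (The binomial tree of dimension $0$ is a single vertex, and that of dimension $d+1$ consists of two binomial trees of dimension $d$ whose roots are joined by an edge, one of them being the new root.) Remove $r$ vertices from $T_k$ by repeating $r$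 times the removal of a leaf that is furthest away from the root (this is possible, and any such choices are allowed). Then connect every vertex to all the roots $v_{m-1},\dots,v_k$. The resulting graph $G$ has $n$ vertices. The numbers of edges of the trees and of the edges contributed by each root ($n-1$ per root) add up to $(m-k+1)n-2(m-k)$; since some edges are counted several times in this sum, the simple graph $G$ has at most $(m-k+1)n-2(m-k)$ edges. For a vertex $u$ that is the root of a binomial tree of dimension $d$ (in the trees before the removal; the dimension is $i$ for $u=v_i$), let $c_j(u)$, $j<d$, be the child of $u$ that is the root of a binomial tree of dimension $j$, and let $$\ell_u=(v_{m-1},v_{m-2},\dots,v_{\max(d,k)},\,c_{d-1}(u),c_{d-2}(u),\dots,c_0(u)),$$ where $u$ itself and the removed children are omitted. These are lists of distinct neighbors, and with them broadcast from every source takes exactly $\lceil\log_2 n\rceil$ rounds. In particular, $G$ is a broadcast graph. -/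

import Mathlib

namespace SourceOblivious

/-! ## The fully-adaptive source-oblivious broadcast model -/

section Model

variable {V : Type*}

/-- A collection of lists for `G`: the list of `v` consists of distinct neighbors of `v`. -/
def IsLists (G : SimpleGraph V) (l : V → List V) : Prop :=
  ∀ v, (l v).Nodup ∧ ∀ u ∈ l v, G.Adj v u

open Classical in
/-- The vertex called by a node with list `l` when the informed vertices are those of `I`:
the first vertex of the list that is not informed yet, if there is one. A node that has been called
is informed forever, so this is also the next such vertex after the one called previously. -/
noncomputable def nextCall (I : Set V) (l : List V) : Option V :=
  l.find? (fun u => decide (u ∉ I))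

/-- The set of vertices informed after `t` rounds of fully-adaptive broadcast from the source `s`
with lists `l`: at each round, every informed vertex calls the first vertex of its list that was
not informed at the end of the previous round. -/
noncomputable def informed (l : V → List V) (s : V) : ℕ → Set V
  | 0 => {s}
  | t + 1 => informed l s t ∪
      {u | ∃ v ∈ informed l s t, nextCall (informed l s t) (l v) = some u}

/-- The number of rounds for broadcasting from `s` to all vertices with lists `l`
(`⊤` if some vertex is never informed). -/
noncomputable def rounds (l : V → List V) (s : V) : ℕ∞ :=
  ⨅ (t : ℕ) (_ : informed l s t = Set.univ), (t : ℕ∞)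

/-- The broadcast time of `G` in the fully-adaptive source-oblivious model: the minimum over all
collections of lists of the maximum over all sources. -/
noncomputable def broadcastTime (G : SimpleGraph V) : ℕ∞ :=
  ⨅ (l : V → List V) (_ : IsLists G l), ⨆ s, rounds l s

/-- `G` is a broadcast graph in the fully-adaptive source-oblivious model: its broadcast time is
`⌈log₂ n⌉`, where `n` is its number of vertices. -/
def IsBroadcastGraph (G : SimpleGraph V) : Prop :=
  broadcastTime G = (Nat.clog 2 (Nat.card V) : ℕ∞)

end Model

/-- The number of consecutive leading `1`s in the binary representation of `n - 1`. -/
def leadingOnes (n : ℕ) : ℕ :=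
  ((Nat.digits 2 (n - 1)).reverse.takeWhile (fun b => b == 1)).length

/-! ## Binomial trees -/

/-- The binomial tree of dimension `d`, with vertices `0, …, 2 ^ d - 1` and root `0` (as a graph
on `ℕ`, where the other numbers are isolated). The tree of dimension `d + 1` consists of two copies
of the tree of dimension `d`, the second one shifted by `2 ^ d`, and an edge between the two
roots. -/
def binomialTree : ℕ → SimpleGraph ℕ
  | 0 => ⊥
  | d + 1 => binomialTree d ⊔ (binomialTree d).map (addRightEmbedding (2 ^ d)) ⊔
      SimpleGraph.edge 0 (2 ^ d)

/-- The dimension of the binomial tree whose root is the vertex `u` of the binomial tree of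
dimension `d`. -/
def rootDim : ℕ → ℕ → ℕ
  | 0, _ => 0
  | d + 1, u =>
      if u = 0 then d + 1 else if u < 2 ^ d then rootDim d u else rootDim d (u - 2 ^ d)

/-- The child of the vertex `u` that is the root of a binomial tree of dimension `j`
(for `j` smaller than the dimension of the tree rooted at `u`). -/
def child (j u : ℕ) : ℕ := u + 2 ^ j

/-- `x` is a leaf of the subgraph of the binomial tree of dimension `k` induced by `S`. -/
def IsLeaf (k : ℕ) (S : Finset ℕ) (x : ℕ) : Prop :=
  x ∈ S ∧ ∃! y, y ∈ S ∧ (binomialTree k).Adj x y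

/-- `Pruned k r S`: the set `S` is obtained from the vertex set of the binomial tree of
dimension `k` by repeating `r` times the removal of a leaf that is furthest away from the root. -/
inductive Pruned (k : ℕ) : ℕ → Finset ℕ → Prop
  | full : Pruned k 0 (Finset.range (2 ^ k))
  | remove {r : ℕ} {S : Finset ℕ} {x : ℕ} (hS : Pruned k r S) (hx : IsLeaf k S x)
      (hfar : ∀ y, IsLeaf k S y → (binomialTree k).dist 0 y ≤ (binomialTree k).dist 0 x) :
      Pruned k (r + 1) (S.erase x)

/-! ## The graph -/

/-- The pair `(i, x)` is a vertex of the union of the trees `T_{m-1}, …, T_k`: here `i` is the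
index of the tree and `x` a vertex of the binomial tree of dimension `i`, and `S` is the set of the
vertices that are left in `T_k`. -/
def IsNode (m k : ℕ) (S : Finset ℕ) (p : ℕ × ℕ) : Prop :=
  k ≤ p.1 ∧ p.1 < m ∧ p.2 < 2 ^ p.1 ∧ (p.1 = k → p.2 ∈ S)

/-- The vertices of the union of the trees `T_{m-1}, …, T_k`. -/
abbrev Node (m k : ℕ) (S : Finset ℕ) : Type := {p : ℕ × ℕ // IsNode m k S p}

/-- The disjoint union of the trees `T_{m-1}, …, T_k`. -/
def forest (m k : ℕ) (S : Finset ℕ) : SimpleGraph (Node m k S) where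
  Adj p q := p.1.1 = q.1.1 ∧ (binomialTree p.1.1).Adj p.1.2 q.1.2
  symm := ⟨fun _ _ h => ⟨h.1.symm, h.1 ▸ h.2.symm⟩⟩
  loopless := ⟨fun _ h => h.2.ne rfl⟩

/-- The edges that connect the root `(i, 0)` of `T_i` to all other vertices. -/
def rootEdges (m k : ℕ) (S : Finset ℕ) (i : ℕ) : SimpleGraph (Node m k S) where
  Adj p q := p ≠ q ∧ (p.1 = (i, 0) ∨ q.1 = (i, 0))
  symm := ⟨fun _ _ h => ⟨h.1.symm, h.2.symm⟩⟩
  loopless := ⟨fun _ h => h.1 rfl⟩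

/-- The union of the trees `T_{m-1}, …, T_k`, where every vertex is connected to all the roots. -/
def treeGraph (m k : ℕ) (S : Finset ℕ) : SimpleGraph (Node m k S) :=
  forest m k S ⊔ ⨆ i ∈ Finset.Ico k m, rootEdges m k S i

open Classical in
/-- The list of the vertex `u` in `T_i`, where `u` is the root of a binomial tree of dimension `d`:
first the roots `v_{m-1}, v_{m-2}, …, v_d` (those among them that exist and are different from
`u`), then the children `c_{d-1}(u), …, c_0(u)` of `u` (those that were not removed). -/
noncomputable def treeLists (m k : ℕ) (S : Finset ℕ) (u : Node m k S) : List (Node m k S) :=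
  let d := rootDim u.1.1 u.1.2
  (((List.range m).reverse.filter (fun j => decide (d ≤ j))).map (fun j => (j, 0)) ++
    (List.range d).reverse.map (fun j => (u.1.1, child j u.1.2))).filterMap
      (fun p => if h : IsNode m k S p ∧ p ≠ u.1 then some ⟨p, h.1⟩ else none)

end SourceOblivious

open SourceOblivious

/-!
The number of informed vertices at most doubles in a round, so no lists on `n` vertices need fewer
than `⌈log₂ n⌉` rounds (`clog_le_rounds`). Everything else is a matter of exhibiting lists that
achieve this bound.

If `n = 2 ^ d`, the hypercube will do, every vertex calling its neighbors in the order of the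
directions: after `t` rounds, the subcube through the source spanned by the first `t` directions is
informed (`mem_informed_hypercube`). Here `L(n) = d`, and there are at most `n * d` edges.

If `n = 2 ^ m - 2 ^ k - r`, then `⌈log₂ n⌉ = m`, and the list of a vertex `u` of the union of the
trees is best seen as having positions `m - 1, …, 0`, where position `j` is the root `v_j` if `j` is
at least the dimension of `u` and the child `c_j(u)` otherwise (`slot`). In both cases it holds a
root of a binomial tree of dimension `j`. The claim is that every vertex of dimension `j` is
informed after `m - j` rounds. If this is so for all dimensions above `j`, then after `m - j - 1`
rounds every informed vertex is done with the positions above `j`, and will have the vertex at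
position `j` informed in the next round (`mem_informed_slot`). This settles the children `c_j(q)`,
since `q` has a larger dimension. It also settles `v_j` as soon as some vertex of dimension at most
`j` is informed after `m - j - 1` rounds. If the source `s` has dimension at most `j`, it is such a
vertex. Otherwise the parent `p` of `s` (or `s` itself if it is a root `v_i`) provides one: `p` need
not call `s`, hence it is one round ahead from then on, and `c_j(p)` is informed after `m - j - 1`
rounds. The two claims are proved together by induction on the number of rounds
(`informed_invariant`).

About the pruned tree one only needs that it is closed under taking parents and contains its root
(`Pruned.isSubtree`): a leaf other than the root has no children left, and the root is not removed
because a leaf furthest away from it is preferred. The edges of the trees are counted by the vertex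
at their lower end (`ncard_edgeSet_forest`). Part (1) follows from the edge count
because `m - k + 1 = L(n) + 2 ≤ 3 * L(n)`.
-/

namespace SourceOblivious

/-! ### Broadcasting with arbitrary lists -/

section Model

variable {V : Type*}

theorem informed_mono (l : V → List V) (s : V) : Monotone (informed l s) :=
  monotone_nat_of_le_succ fun _ => Set.subset_union_left

theorem source_mem_informed (l : V → List V) (s : V) (t : ℕ) : s ∈ informed l s t :=
  informed_mono l s (Nat.zero_le t) (Set.mem_singleton s)

/-- If everything before `x` in the list of an informed vertex is informed, then `x` is informed
one round later: either it already was, or it is the vertex called in that round. -/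
theorem mem_informed_succ {l : V → List V} {s u x : V} {t : ℕ} {A B : List V}
    (hu : u ∈ informed l s t) (hl : l u = A ++ x :: B) (hA : ∀ y ∈ A, y ∈ informed l s t) :
    x ∈ informed l s (t + 1) := by
  classical
  by_cases hx : x ∈ informed l s t
  · exact informed_mono l s (Nat.le_succ t) hx
  · refine Or.inr ⟨u, hu, ?_⟩
    have : A.find? (fun v => decide (v ∉ informed l s t)) = none := by
      simpa [List.find?_eq_none] using hA
    rw [nextCall, hl, List.find?_append, this]
    simp [hx]

theorem ncard_informed_le [Finite V] (l : V → List V) (s : V) (t : ℕ) :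
    (informed l s t).ncard ≤ 2 ^ t := by
  induction t with
  | zero => simp [informed]
  | succ t ih =>
    have hsub : {u | ∃ v ∈ informed l s t, nextCall (informed l s t) (l v) = some u} ⊆
        (fun v => (nextCall (informed l s t) (l v)).getD v) '' informed l s t := by
      rintro u ⟨v, hv, h⟩
      exact ⟨v, hv, by simp [h]⟩
    have h1 := (Set.ncard_le_ncard hsub (Set.toFinite _)).trans
      (Set.ncard_image_le (Set.toFinite _))
    have h2 := Set.ncard_union_le (informed l s t)
      {u | ∃ v ∈ informed l s t, nextCall (informed l s t) (l v) = some u}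
    rw [informed, pow_succ]
    omega

theorem clog_le_rounds [Finite V] (l : V → List V) (s : V) :
    (Nat.clog 2 (Nat.card V) : ℕ∞) ≤ rounds l s := by
  refine le_iInf₂ fun t ht => ?_
  have h := ncard_informed_le l s t
  rw [ht, Set.ncard_univ] at h
  exact_mod_cast Nat.clog_le_of_le_pow h

theorem rounds_le {l : V → List V} {s : V} {t : ℕ} (h : informed l s t = Set.univ) :
    rounds l s ≤ t :=
  iInf₂_le t h

theorem rounds_eq_clog [Finite V] {l : V → List V} {s : V}
    (h : informed l s (Nat.clog 2 (Nat.card V)) = Set.univ) :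
    rounds l s = (Nat.clog 2 (Nat.card V) : ℕ∞) :=
  le_antisymm (rounds_le h) (clog_le_rounds l s)

theorem isBroadcastGraph_of_lists [Finite V] [Nonempty V] {G : SimpleGraph V} {l : V → List V}
    (hl : IsLists G l) (h : ∀ s, informed l s (Nat.clog 2 (Nat.card V)) = Set.univ) :
    IsBroadcastGraph G := by
  refine le_antisymm (iInf₂_le_of_le l hl (iSup_le fun s => rounds_le (h s))) ?_
  obtain ⟨s⟩ := ‹Nonempty V›
  exact le_iInf₂ fun l' _ => (clog_le_rounds l' s).trans (le_iSup (rounds l') s)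

theorem informed_map_equiv {W : Type*} (e : V ≃ W) (l : V → List V) (s : V) (t : ℕ) :
    informed (fun w => (l (e.symm w)).map e) (e s) t = e '' informed l s t := by
  classical
  induction t with
  | zero => simp [informed]
  | succ t ih =>
    have hcall (v : V) : nextCall (e '' informed l s t) ((l v).map e) =
        (nextCall (informed l s t) (l v)).map e := by
      simp only [nextCall, List.find?_map]
      congr 2
      ext v
      simp
    rw [informed, informed, ih, Set.image_union]
    congr 1
    ext w
    constructor
    · rintro ⟨_, ⟨v, hv, rfl⟩, h⟩
      rw [e.symm_apply_apply, hcall, Option.map_eq_some_iff] at h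
      obtain ⟨u, hu, rfl⟩ := h
      exact ⟨u, ⟨v, hv, hu⟩, rfl⟩
    · rintro ⟨u, ⟨v, hv, hu⟩, rfl⟩
      exact ⟨e v, ⟨v, hv, rfl⟩, by rw [e.symm_apply_apply, hcall, hu]; rfl⟩

/-- A graph with lists that achieve the optimal broadcast time can be carried over to the vertex
set `Fin n`. -/
theorem exists_isBroadcastGraph_fin [Finite V] [Nonempty V] {G : SimpleGraph V}
    {l : V → List V} (hl : IsLists G l)
    (h : ∀ s, informed l s (Nat.clog 2 (Nat.card V)) = Set.univ) {n : ℕ} (hn : Nat.card V = n) :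
    ∃ H : SimpleGraph (Fin n), IsBroadcastGraph H ∧ H.edgeSet.ncard = G.edgeSet.ncard := by
  let e : V ≃ Fin n := Finite.equivFinOfCardEq hn
  have : Nonempty (Fin n) := ⟨e (Classical.arbitrary V)⟩
  refine ⟨G.map e.toEmbedding, isBroadcastGraph_of_lists
    (l := fun w => (l (e.symm w)).map e) (fun w => ⟨?_, ?_⟩) fun w => ?_, ?_⟩
  · exact (hl _).1.map e.injective
  · intro u hu
    obtain ⟨x, hx, rfl⟩ := List.mem_map.1 hu
    have hadj := (hl _).2 x hx
    exact ⟨fun h => hadj.ne (by rw [h, e.symm_apply_apply]), e.symm w, x, hadj, by simp, rfl⟩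
  · obtain ⟨s, rfl⟩ := e.surjective w
    rw [informed_map_equiv, Nat.card_congr e.symm, h, Set.image_univ, e.range_eq_univ]
  · rw [SimpleGraph.edgeSet_map]
    exact Set.ncard_image_of_injective _ (Function.Embedding.injective _)

end Model

/-! ### The hypercube -/

section Hypercube

/-- The neighbor of `v` in direction `i` in the hypercube. -/
def flipAt {d : ℕ} (v : Fin d → Bool) (i : Fin d) : Fin d → Bool :=
  Function.update v i (!v i)

theorem flipAt_flipAt {d : ℕ} (v : Fin d → Bool) (i : Fin d) : flipAt (flipAt v i) i = v := by
  simp [flipAt]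

theorem flipAt_ne {d : ℕ} (v : Fin d → Bool) (i : Fin d) : v ≠ flipAt v i := fun h => by
  have := congrFun h i
  simp [flipAt] at this

theorem flipAt_injective {d : ℕ} (v : Fin d → Bool) : Function.Injective (flipAt v) := by
  intro i j h
  by_contra hij
  have := congrFun h i
  simp [flipAt, Function.update_of_ne hij] at this

/-- The hypercube of dimension `d`. -/
def hypercube (d : ℕ) : SimpleGraph (Fin d → Bool) where
  Adj v w := ∃ i, w = flipAt v i
  symm := ⟨fun _ _ ⟨i, hi⟩ => ⟨i, by rw [hi, flipAt_flipAt]⟩⟩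
  loopless := ⟨fun v ⟨i, hi⟩ => flipAt_ne v i hi⟩

/-- Every vertex of the hypercube calls its neighbors in the order of the directions. -/
def hypercubeLists (d : ℕ) (v : Fin d → Bool) : List (Fin d → Bool) :=
  (List.finRange d).map (flipAt v)

theorem isLists_hypercube (d : ℕ) : IsLists (hypercube d) (hypercubeLists d) := by
  refine fun v => ⟨(List.nodup_finRange d).map (flipAt_injective v), fun u hu => ?_⟩
  obtain ⟨i, -, rfl⟩ := List.mem_map.1 hu
  exact ⟨i, rfl⟩

/-- After `t` rounds, the subcube through the source spanned by the first `t` directions is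
informed. -/
theorem mem_informed_hypercube {d : ℕ} (s : Fin d → Bool) (t : ℕ) (v : Fin d → Bool)
    (hv : ∀ i : Fin d, t ≤ i → v i = s i) : v ∈ informed (hypercubeLists d) s t := by
  induction t generalizing v with
  | zero => exact funext fun i => hv i (Nat.zero_le _)
  | succ t ih =>
    by_cases h : ∀ i : Fin d, t ≤ i → v i = s i
    · exact informed_mono _ s (Nat.le_succ t) (ih v h)
    · push Not at h
      obtain ⟨i, hti, hi⟩ := h
      obtain rfl : t = i := by
        by_contra hne
        exact hi (hv i (by omega))
      have hsplit : hypercubeLists d (flipAt v i) = (((List.finRange d).take i).map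
          (flipAt (flipAt v i))) ++ v :: ((List.finRange d).drop (i + 1)).map
          (flipAt (flipAt v i)) := by
        conv_lhs => rw [hypercubeLists, ← List.take_append_drop i (List.finRange d),
          List.drop_eq_getElem_cons (by simp)]
        simp [flipAt_flipAt]
      have hw (j : Fin d) (hj : (i : ℕ) ≤ j) : flipAt v i j = s j := by
        by_cases hij : j = i
        · subst hij
          cases h1 : v j <;> cases h2 : s j <;> simp_all [flipAt]
        · rw [flipAt, Function.update_of_ne hij]
          exact hv j (by have := Fin.val_ne_of_ne hij; omega)
      refine mem_informed_succ (ih _ hw) hsplit fun y hy => ?_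
      obtain ⟨j, hj, rfl⟩ := List.mem_map.1 hy
      have hji : j < i := by
        obtain ⟨a, ha, rfl⟩ := List.mem_take_iff_getElem.1 hj
        simp only [Fin.lt_def, List.getElem_finRange]
        simp at ha ⊢
        omega
      refine ih _ fun a ha => ?_
      rw [flipAt, Function.update_of_ne (by rintro rfl; exact absurd hji (by simpa using ha))]
      exact hw a ha

theorem ncard_edgeSet_hypercube_le (d : ℕ) : (hypercube d).edgeSet.ncard ≤ 2 ^ d * d := by
  have hsub : (hypercube d).edgeSet ⊆
      Set.range fun p : (Fin d → Bool) × Fin d => s(p.1, flipAt p.1 p.2) := by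
    rintro ⟨v, w⟩ ⟨i, hi⟩
    exact ⟨(v, i), congrArg (fun u => s(v, u)) hi.symm⟩
  refine (Set.ncard_le_ncard hsub (Set.toFinite _)).trans ?_
  rw [← Set.image_univ]
  refine (Set.ncard_image_le (Set.toFinite _)).trans ?_
  simp [Set.ncard_univ]

theorem exists_isBroadcastGraph_two_pow (d : ℕ) : ∃ G : SimpleGraph (Fin (2 ^ d)),
    IsBroadcastGraph G ∧ G.edgeSet.ncard ≤ 2 ^ d * d := by
  have hcard : Nat.card (Fin d → Bool) = 2 ^ d := by simp
  obtain ⟨G, hG, hE⟩ := exists_isBroadcastGraph_fin (isLists_hypercube d) (fun s => by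
    rw [hcard, Nat.clog_pow 2 d one_lt_two]
    exact Set.eq_univ_of_forall fun v => mem_informed_hypercube s d v fun i hi => by omega) hcard
  exact ⟨G, hG, hE.trans_le (ncard_edgeSet_hypercube_le d)⟩

end Hypercube

/-! ### Leading ones and the representation of the number of vertices -/

theorem digits_two_reverse {N : ℕ} (hN : N ≠ 0) :
    (Nat.digits 2 N).reverse = (Nat.digits 2 (N / 2)).reverse ++ [N % 2] := by
  rw [Nat.digits_def' one_lt_two (Nat.pos_of_ne_zero hN), List.reverse_cons]

theorem digits_two_reverse_two_pow_sub_one (a : ℕ) :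
    (Nat.digits 2 (2 ^ a - 1)).reverse = List.replicate a 1 := by
  induction a with
  | zero => simp
  | succ a ih =>
    have := Nat.one_le_two_pow (n := a)
    rw [digits_two_reverse (by rw [pow_succ]; omega),
      show (2 ^ (a + 1) - 1) / 2 = 2 ^ a - 1 by rw [pow_succ]; omega,
      show (2 ^ (a + 1) - 1) % 2 = 1 by rw [pow_succ]; omega, ih, List.replicate_succ']

/-- If `q < 2 ^ k`, then the number consisting of `a` ones followed by `q` written with `k + 1`
digits has a zero after these ones. -/
theorem exists_digits_two_reverse {a : ℕ} (ha : a ≠ 0) (k q : ℕ) (hq : q < 2 ^ k) :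
    ∃ R, (Nat.digits 2 ((2 ^ a - 1) * 2 ^ (k + 1) + q)).reverse =
      List.replicate a 1 ++ 0 :: R := by
  have h1 : 0 < 2 ^ a - 1 := by
    have := Nat.one_lt_two_pow ha
    omega
  induction k generalizing q with
  | zero =>
    obtain rfl : q = 0 := by simpa using hq
    refine ⟨[], ?_⟩
    rw [digits_two_reverse (by omega),
      show ((2 ^ a - 1) * 2 ^ (0 + 1) + 0) / 2 = 2 ^ a - 1 by omega,
      digits_two_reverse_two_pow_sub_one]
    simp
  | succ k ih =>
    obtain ⟨R, hR⟩ := ih (q / 2) (by rw [pow_succ] at hq; omega)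
    have hpos : 0 < (2 ^ a - 1) * 2 ^ (k + 1) := by positivity
    have hdiv : ((2 ^ a - 1) * 2 ^ (k + 1 + 1) + q) / 2 = (2 ^ a - 1) * 2 ^ (k + 1) + q / 2 := by
      rw [pow_succ _ (k + 1), ← mul_assoc]
      omega
    refine ⟨R ++ [((2 ^ a - 1) * 2 ^ (k + 1 + 1) + q) % 2], ?_⟩
    rw [digits_two_reverse (by rw [pow_succ _ (k + 1), ← mul_assoc]; omega), hdiv, hR]
    simp

theorem leadingOnes_two_pow (d : ℕ) : leadingOnes (2 ^ d) = d := by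
  rw [leadingOnes, digits_two_reverse_two_pow_sub_one]
  simp

theorem leadingOnes_add {n m k r : ℕ} (hk : k + 2 ≤ m) (hr : r < 2 ^ k)
    (h : n + 2 ^ k + r = 2 ^ m) : leadingOnes n + k + 1 = m := by
  obtain ⟨a, rfl⟩ : ∃ a, m = a + (k + 1) := ⟨m - (k + 1), by omega⟩
  have h1 : 2 ^ (k + 1) ≤ 2 ^ a * 2 ^ (k + 1) := Nat.le_mul_of_pos_left _ (by positivity)
  have hn : n - 1 = (2 ^ a - 1) * 2 ^ (k + 1) + (2 ^ k - 1 - r) := by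
    rw [pow_add] at h
    rw [Nat.sub_mul, one_mul]
    rw [pow_succ] at *
    omega
  obtain ⟨R, hR⟩ := exists_digits_two_reverse (a := a) (by omega) k (2 ^ k - 1 - r) (by omega)
  rw [leadingOnes, hn, hR, List.takeWhile_append]
  simp
  omega

theorem exists_two_pow_representation {n : ℕ} (hn : 1 ≤ n) (h2 : ∀ d : ℕ, n ≠ 2 ^ d) :
    ∃ m k r : ℕ, k + 2 ≤ m ∧ r < 2 ^ k ∧ n + 2 ^ k + r = 2 ^ m := by
  have hn1 : 1 < n := lt_of_le_of_ne hn fun h => h2 0 (by simpa using h.symm)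
  obtain ⟨m, hm⟩ : ∃ m, Nat.clog 2 n = m + 1 :=
    Nat.exists_eq_succ_of_ne_zero (Nat.clog_pos one_lt_two hn1).ne'
  have hle : n ≤ 2 ^ (m + 1) := hm ▸ Nat.le_pow_clog one_lt_two n
  have hlt : 2 ^ m < n := (Nat.lt_clog_iff_pow_lt one_lt_two).1 (by omega)
  have hne := h2 (m + 1)
  set x := 2 ^ (m + 1) - n with hx
  have hx0 : x ≠ 0 := by omega
  have hk1 := Nat.pow_log_le_self 2 hx0
  have hk2 := Nat.lt_pow_succ_log_self one_lt_two x
  refine ⟨m + 1, Nat.log 2 x, x - 2 ^ Nat.log 2 x, ?_, ?_, ?_⟩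
  · have : 2 ^ Nat.log 2 x < 2 ^ m := by
      rw [pow_succ] at hx
      omega
    have := (Nat.pow_lt_pow_iff_right one_lt_two).1 this
    omega
  · rw [pow_succ] at hk2
    omega
  · omega

theorem clog_of_representation {n m k r : ℕ} (hk : k + 2 ≤ m) (hr : r < 2 ^ k)
    (h : n + 2 ^ k + r = 2 ^ m) : Nat.clog 2 n = m := by
  obtain ⟨a, rfl⟩ : ∃ a, m = a + 1 := ⟨m - 1, by omega⟩
  have h1 : 2 ^ (k + 1) ≤ 2 ^ a := Nat.pow_le_pow_right two_pos (by omega)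
  rw [pow_succ] at h h1
  refine le_antisymm (Nat.clog_le_of_le_pow (by rw [pow_succ]; omega)) ?_
  exact (Nat.lt_clog_iff_pow_lt one_lt_two).2 (by omega)

/-! ### Binomial trees in binary

The vertices of the binomial tree of dimension `d` are the numbers below `2 ^ d`; the parent of a
nonzero number arises by deleting its last binary digit `1`, and the dimension of the tree rooted
at it is the position of that digit. -/

theorem rootDim_zero (d : ℕ) : rootDim d 0 = d := by
  cases d <;> simp [rootDim]

theorem le_rootDim_iff {d u j : ℕ} (hu : u < 2 ^ d) : j ≤ rootDim d u ↔ j ≤ d ∧ 2 ^ j ∣ u := by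
  induction d generalizing u with
  | zero =>
    obtain rfl : u = 0 := by simpa using hu
    simp [rootDim]
  | succ d ih =>
    rw [rootDim]
    split_ifs with h0 h1
    · simp [h0]
    · rw [ih h1]
      refine and_congr_left fun hj => ⟨by omega, fun h => ?_⟩
      have : 2 ^ j < 2 ^ d := (Nat.le_of_dvd (by omega) hj).trans_lt h1
      exact ((Nat.pow_lt_pow_iff_right one_lt_two).1 this).le
    · rw [ih (by rw [pow_succ] at hu; omega)]
      constructor
      · rintro ⟨hj, h⟩
        refine ⟨by omega, ?_⟩
        have := Nat.dvd_add h (pow_dvd_pow 2 hj)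
        rwa [Nat.sub_add_cancel (by omega)] at this
      · rintro ⟨-, h⟩
        have hj : j ≤ d := by
          have : 2 ^ j < 2 ^ (d + 1) := (Nat.le_of_dvd (by omega) h).trans_lt hu
          have := (Nat.pow_lt_pow_iff_right one_lt_two).1 this
          omega
        exact ⟨hj, Nat.dvd_sub h (pow_dvd_pow 2 hj)⟩

theorem rootDim_le {d u : ℕ} (hu : u < 2 ^ d) : rootDim d u ≤ d :=
  ((le_rootDim_iff hu).1 le_rfl).1

theorem add_two_pow_succ_le {d j x : ℕ} (hx : x < 2 ^ d) (hj : j < d) (h : 2 ^ (j + 1) ∣ x) :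
    x + 2 ^ (j + 1) ≤ 2 ^ d := by
  have hd : 2 ^ (j + 1) ∣ 2 ^ d - x := Nat.dvd_sub (pow_dvd_pow 2 hj) h
  have := Nat.le_of_dvd (by omega) hd
  omega

theorem child_lt {d j x : ℕ} (hx : x < 2 ^ d) (hj : j < rootDim d x) : child j x < 2 ^ d := by
  obtain ⟨h1, h2⟩ := (le_rootDim_iff hx).1 (Nat.succ_le_of_lt hj)
  have := add_two_pow_succ_le hx h1 h2
  have := Nat.two_pow_pos j
  rw [pow_succ] at *
  rw [child]
  omega

theorem not_two_pow_succ_dvd_child {j x : ℕ} (h : 2 ^ (j + 1) ∣ x) :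
    ¬ 2 ^ (j + 1) ∣ child j x := by
  rw [child, Nat.dvd_add_right h]
  intro h'
  have := Nat.le_of_dvd (by positivity) h'
  have := Nat.two_pow_pos j
  rw [pow_succ] at *
  omega

theorem rootDim_child {d j x : ℕ} (hx : x < 2 ^ d) (hj : j < rootDim d x) :
    rootDim d (child j x) = j := by
  obtain ⟨h1, h2⟩ := (le_rootDim_iff hx).1 (Nat.succ_le_of_lt hj)
  have hc := child_lt hx hj
  refine le_antisymm ?_ ?_
  · by_contra! h
    exact not_two_pow_succ_dvd_child h2 ((le_rootDim_iff hc).1 h).2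
  · exact (le_rootDim_iff hc).2 ⟨by omega,
      Nat.dvd_add ((pow_dvd_pow 2 (Nat.le_succ j)).trans h2) dvd_rfl⟩

theorem exists_eq_child {d x : ℕ} (hx : x < 2 ^ d) (h0 : x ≠ 0) :
    ∃ y < 2 ^ d, rootDim d x < rootDim d y ∧ child (rootDim d x) y = x := by
  obtain ⟨j, hj⟩ : ∃ j, j = rootDim d x := ⟨_, rfl⟩
  rw [← hj]
  obtain ⟨h1, h2⟩ := (le_rootDim_iff hx).1 hj.le
  have hjx := Nat.le_of_dvd (by omega) h2
  have hjd : j < d := (Nat.pow_lt_pow_iff_right one_lt_two).1 (hjx.trans_lt hx)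
  have h3 : ¬ 2 ^ (j + 1) ∣ x := fun h =>
    absurd ((le_rootDim_iff hx).2 ⟨hjd, h⟩) (by omega)
  have h4 : 2 ^ (j + 1) ∣ x - 2 ^ j := by
    obtain ⟨c, rfl⟩ := h2
    rw [pow_succ, Nat.mul_dvd_mul_iff_left (Nat.two_pow_pos j)] at h3
    rw [pow_succ, show 2 ^ j * c - 2 ^ j = 2 ^ j * (c - 1) by rw [Nat.mul_sub, mul_one],
      Nat.mul_dvd_mul_iff_left (Nat.two_pow_pos j)]
    omega
  exact ⟨x - 2 ^ j, by omega, (le_rootDim_iff (by omega)).2 ⟨hjd, h4⟩, Nat.sub_add_cancel hjx⟩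

theorem lt_child (j x : ℕ) : x < child j x :=
  Nat.lt_add_of_pos_right (Nat.two_pow_pos j)

/-- A vertex is the child of only one vertex. -/
theorem child_inj {d i j x y : ℕ} (hx : x < 2 ^ d) (hy : y < 2 ^ d) (hi : i < rootDim d x)
    (hj : j < rootDim d y) (h : child i x = child j y) : x = y := by
  obtain rfl : i = j := by rw [← rootDim_child hx hi, h, rootDim_child hy hj]
  exact Nat.add_right_cancel h

theorem binomialTree_adj_iff_exists_dvd {d x y : ℕ} :
    (binomialTree d).Adj x y ↔ x < 2 ^ d ∧ y < 2 ^ d ∧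
      ∃ j, (2 ^ (j + 1) ∣ x ∧ y = child j x) ∨ (2 ^ (j + 1) ∣ y ∧ x = child j y) := by
  induction d generalizing x y with
  | zero =>
    simp only [binomialTree, SimpleGraph.bot_adj, false_iff]
    rintro ⟨hx, hy, j, ⟨-, h⟩ | ⟨-, h⟩⟩
    · have := lt_child j x
      omega
    · have := lt_child j y
      omega
  | succ d ih =>
    simp only [binomialTree, SimpleGraph.sup_adj, SimpleGraph.map_adj, SimpleGraph.edge_adj, ih]
    constructor
    · rintro ((⟨hx, hy, h⟩ | ⟨x', y', ⟨hx, hy, j, h⟩, rfl, rfl⟩) | ⟨⟨rfl, rfl⟩ | ⟨rfl, rfl⟩, -⟩)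
      · exact ⟨by rw [pow_succ]; omega, by rw [pow_succ]; omega, h⟩
      · refine ⟨by rw [pow_succ, addRightEmbedding_apply]; omega,
          by rw [pow_succ, addRightEmbedding_apply]; omega, j, ?_⟩
        have hj : 2 ^ (j + 1) ∣ 2 ^ d := by
          refine pow_dvd_pow 2 ((Nat.pow_lt_pow_iff_right one_lt_two).1 (?_ : 2 ^ j < 2 ^ d))
          rcases h with ⟨-, rfl⟩ | ⟨-, rfl⟩ <;> rw [child] at * <;> omega
        rcases h with ⟨h, rfl⟩ | ⟨h, rfl⟩
        · exact Or.inl ⟨Nat.dvd_add h hj, by simp only [child, addRightEmbedding_apply]; omega⟩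
        · exact Or.inr ⟨Nat.dvd_add h hj, by simp only [child, addRightEmbedding_apply]; omega⟩
      · exact ⟨by positivity, by rw [pow_succ]; have := Nat.two_pow_pos d; omega, d,
          Or.inl ⟨dvd_zero _, by simp [child]⟩⟩
      · exact ⟨by rw [pow_succ]; have := Nat.two_pow_pos d; omega, by positivity, d,
          Or.inr ⟨dvd_zero _, by simp [child]⟩⟩
    · have key {x y j : ℕ} (hy : y < 2 ^ (d + 1)) (hdvd : 2 ^ (j + 1) ∣ x) (hxy : y = child j x) :
          y < 2 ^ d ∨ (2 ^ d ≤ x ∧ 2 ^ (j + 1) ∣ x - 2 ^ d) ∨ (x = 0 ∧ y = 2 ^ d) := by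
        by_cases hyd : y < 2 ^ d
        · exact Or.inl hyd
        have hjy : 2 ^ j ≤ y := by rw [hxy, child]; omega
        have hjd : j < d + 1 := (Nat.pow_lt_pow_iff_right one_lt_two).1 (hjy.trans_lt hy)
        by_cases hxd : 2 ^ d ≤ x
        · have : j < d := by
            refine (Nat.pow_lt_pow_iff_right one_lt_two).1 (?_ : 2 ^ j < 2 ^ d)
            rw [hxy, child, pow_succ] at hy
            omega
          exact Or.inr (Or.inl ⟨hxd, Nat.dvd_sub hdvd (pow_dvd_pow 2 this)⟩)
        · obtain rfl : j = d := by
            by_contra hne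
            have := add_two_pow_succ_le (by omega) (by omega : j < d) hdvd
            have := Nat.two_pow_pos j
            rw [hxy, child] at hyd
            rw [pow_succ] at *
            omega
          obtain rfl : x = 0 := by
            refine Nat.eq_zero_of_dvd_of_lt hdvd ?_
            rw [pow_succ]
            omega
          exact Or.inr (Or.inr ⟨rfl, by rw [hxy, child, zero_add]⟩)
      have hpos := Nat.two_pow_pos d
      rintro ⟨hx, hy, j, ⟨hdvd, hxy⟩ | ⟨hdvd, hxy⟩⟩
      · have hlt := lt_child j x
        rcases key hy hdvd hxy with h | ⟨h, h'⟩ | ⟨rfl, rfl⟩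
        · exact Or.inl (Or.inl ⟨by omega, h, j, Or.inl ⟨hdvd, hxy⟩⟩)
        · rw [pow_succ] at hx hy
          refine Or.inl (Or.inr ⟨x - 2 ^ d, y - 2 ^ d, ⟨by omega, by omega, j,
            Or.inl ⟨h', by rw [hxy, child, child]; omega⟩⟩, ?_, ?_⟩) <;>
            rw [addRightEmbedding_apply] <;> omega
        · exact Or.inr ⟨Or.inl ⟨rfl, rfl⟩, by omega⟩
      · have hlt := lt_child j y
        rcases key hx hdvd hxy with h | ⟨h, h'⟩ | ⟨rfl, rfl⟩
        · exact Or.inl (Or.inl ⟨h, by omega, j, Or.inr ⟨hdvd, hxy⟩⟩)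
        · rw [pow_succ] at hx hy
          refine Or.inl (Or.inr ⟨x - 2 ^ d, y - 2 ^ d, ⟨by omega, by omega, j,
            Or.inr ⟨h', by rw [hxy, child, child]; omega⟩⟩, ?_, ?_⟩) <;>
            rw [addRightEmbedding_apply] <;> omega
        · exact Or.inr ⟨Or.inr ⟨rfl, rfl⟩, by omega⟩

/-- `IsChild d x y`: in the binomial tree of dimension `d`, the vertex `y` is a child of `x`. -/
def IsChild (d x y : ℕ) : Prop :=
  x < 2 ^ d ∧ ∃ j < rootDim d x, y = child j x

theorem binomialTree_adj {d x y : ℕ} :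
    (binomialTree d).Adj x y ↔ IsChild d x y ∨ IsChild d y x := by
  have key {x y j : ℕ} (hx : x < 2 ^ d) (hy : y < 2 ^ d) (hdvd : 2 ^ (j + 1) ∣ x)
      (hxy : y = child j x) : IsChild d x y := by
    refine ⟨hx, j, (le_rootDim_iff hx).2 ⟨?_, hdvd⟩, hxy⟩
    refine (Nat.pow_lt_pow_iff_right one_lt_two).1 (?_ : 2 ^ j < 2 ^ d)
    rw [child] at hxy
    omega
  have key' {x y : ℕ} (h : IsChild d x y) : x < 2 ^ d ∧ y < 2 ^ d ∧
      ∃ j, 2 ^ (j + 1) ∣ x ∧ y = child j x := by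
    obtain ⟨hx, j, hj, rfl⟩ := h
    exact ⟨hx, child_lt hx hj, j, ((le_rootDim_iff hx).1 hj).2, rfl⟩
  rw [binomialTree_adj_iff_exists_dvd]
  constructor
  · rintro ⟨hx, hy, j, ⟨h1, h2⟩ | ⟨h1, h2⟩⟩
    exacts [Or.inl (key hx hy h1 h2), Or.inr (key hy hx h1 h2)]
  · rintro (h | h)
    · obtain ⟨hx, hy, j, h⟩ := key' h
      exact ⟨hx, hy, j, Or.inl h⟩
    · obtain ⟨hy, hx, j, h⟩ := key' h
      exact ⟨hx, hy, j, Or.inr h⟩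

theorem IsChild.lt {d x y : ℕ} (h : IsChild d x y) : x < y := by
  obtain ⟨-, j, -, rfl⟩ := h
  exact lt_child j x

theorem IsChild.eq {d x x' y : ℕ} (h : IsChild d x y) (h' : IsChild d x' y) : x = x' := by
  obtain ⟨hx, i, hi, rfl⟩ := h
  obtain ⟨hx', j, hj, h⟩ := h'
  exact child_inj hx hx' hi hj h

theorem exists_isChild {d y : ℕ} (hy : y < 2 ^ d) (h0 : y ≠ 0) : ∃ x, IsChild d x y := by
  obtain ⟨x, hx, hlt, h⟩ := exists_eq_child hy h0
  exact ⟨x, hx, _, hlt, h.symm⟩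

theorem binomialTree_reachable {d x : ℕ} (hx : x < 2 ^ d) : (binomialTree d).Reachable 0 x := by
  induction x using Nat.strong_induction_on with
  | _ x ih =>
    by_cases h0 : x = 0
    · rw [h0]
    · obtain ⟨y, hy⟩ := exists_isChild hx h0
      exact (ih y hy.lt (hy.lt.trans hx)).trans
        (binomialTree_adj.2 (Or.inl hy)).reachable

/-! ### Pruned binomial trees -/

/-- `S` is the vertex set of a subtree of the binomial tree of dimension `k` that contains the
root: it contains `0`, and with every other vertex its parent. -/
structure IsSubtree (k : ℕ) (S : Finset ℕ) : Prop where
  subset : S ⊆ Finset.range (2 ^ k)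
  zero_mem : 0 ∈ S
  parent_mem : ∀ x y, IsChild k x y → y ∈ S → x ∈ S

theorem IsSubtree.lt {k : ℕ} {S : Finset ℕ} (hS : IsSubtree k S) {x : ℕ} (hx : x ∈ S) :
    x < 2 ^ k :=
  Finset.mem_range.1 (hS.subset hx)

/-- The largest vertex has no child, since children are larger than their parents. -/
theorem IsSubtree.exists_isLeaf {k : ℕ} {S : Finset ℕ} (hS : IsSubtree k S) (h : 1 < S.card) :
    ∃ x ≠ 0, IsLeaf k S x := by
  obtain ⟨a, ha, ha0⟩ := Finset.exists_mem_ne h 0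
  have hne : S.Nonempty := ⟨a, ha⟩
  have hmax := S.max'_mem hne
  have h0 : S.max' hne ≠ 0 := by
    have := S.le_max' a ha
    omega
  obtain ⟨y, hy⟩ := exists_isChild (hS.lt hmax) h0
  refine ⟨_, h0, hmax, y, ⟨hS.parent_mem _ _ hy hmax, binomialTree_adj.2 (Or.inr hy)⟩, ?_⟩
  rintro z ⟨hz, hadj⟩
  rcases binomialTree_adj.1 hadj with h | h
  · exact absurd (S.le_max' z hz) (by have := h.lt; omega)
  · exact h.eq hy

theorem IsSubtree.erase {k : ℕ} {S : Finset ℕ} (hS : IsSubtree k S) {x : ℕ} (hx : IsLeaf k S x)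
    (h0 : x ≠ 0) : IsSubtree k (S.erase x) where
  subset := (S.erase_subset x).trans hS.subset
  zero_mem := Finset.mem_erase.2 ⟨h0.symm, hS.zero_mem⟩
  parent_mem y z hyz hz := by
    replace hz : z ∈ S := (Finset.mem_erase.1 hz).2
    refine Finset.mem_erase.2 ⟨?_, hS.parent_mem y z hyz hz⟩
    rintro rfl
    -- otherwise the leaf would have both a child and a parent as neighbors
    obtain ⟨w, hw⟩ := exists_isChild (hS.lt hx.1) h0
    have := hx.2.unique ⟨hz, binomialTree_adj.2 (Or.inl hyz)⟩
      ⟨hS.parent_mem w y hw hx.1, binomialTree_adj.2 (Or.inr hw)⟩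
    have := hyz.lt
    have := hw.lt
    omega

theorem isSubtree_range (k : ℕ) : IsSubtree k (Finset.range (2 ^ k)) where
  subset := subset_rfl
  zero_mem := Finset.mem_range.2 (Nat.two_pow_pos k)
  parent_mem _ _ h _ := Finset.mem_range.2 h.1

/-- The root may become a leaf, but it is never removed: as long as there is another vertex, there
is a leaf at positive distance from the root. -/
theorem Pruned.isSubtree {k r : ℕ} {S : Finset ℕ} (hS : Pruned k r S) (hr : r < 2 ^ k) :
    IsSubtree k S ∧ S.card + r = 2 ^ k := by
  induction hS with
  | full => exact ⟨isSubtree_range k, by simp⟩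
  | @remove r S x _ hx hfar ih =>
    obtain ⟨hT, hcard⟩ := ih (by omega)
    obtain ⟨y, hy0, hy⟩ := hT.exists_isLeaf (by omega)
    have hpos : 0 < (binomialTree k).dist 0 y :=
      (binomialTree_reachable (hT.lt hy.1)).pos_dist_of_ne hy0.symm
    have h0 : x ≠ 0 := by
      rintro rfl
      have := hfar y hy
      rw [SimpleGraph.dist_self] at this
      omega
    exact ⟨hT.erase hx h0, by rw [Finset.card_erase_of_mem hx.1]; omega⟩

theorem exists_pruned {k r : ℕ} (hr : r < 2 ^ k) : ∃ S, Pruned k r S := by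
  classical
  induction r with
  | zero => exact ⟨_, Pruned.full⟩
  | succ r ih =>
    obtain ⟨S, hS⟩ := ih (by omega)
    obtain ⟨hT, hcard⟩ := hS.isSubtree (by omega)
    obtain ⟨y, -, hy⟩ := hT.exists_isLeaf (by omega)
    obtain ⟨x, hx, hmax⟩ := (S.filter (IsLeaf k S)).exists_max_image ((binomialTree k).dist 0)
      ⟨y, Finset.mem_filter.2 ⟨hy.1, hy⟩⟩
    exact ⟨_, hS.remove (Finset.mem_filter.1 hx).2
      fun z hz => hmax z (Finset.mem_filter.2 ⟨hz.1, hz⟩)⟩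

/-! ### The vertices of the forest and their lists -/

section Graph

variable {m k : ℕ} {S : Finset ℕ}

/-- The dimension of the binomial tree rooted at the vertex `u`. -/
def nodeDim (u : Node m k S) : ℕ := rootDim u.1.1 u.1.2

/-- The vertex at position `j` of the list of `u`, where the positions are counted downwards from
`m - 1` to `0`: it is the root `v_j` if `j` is at least the dimension of `u`, and the child
`c_j(u)` otherwise. The pair need not be a vertex. -/
def slot (u : Node m k S) (j : ℕ) : ℕ × ℕ :=
  if nodeDim u ≤ j then (j, 0) else (u.1.1, child j u.1.2)

theorem slot_of_le {u : Node m k S} {j : ℕ} (h : nodeDim u ≤ j) : slot u j = (j, 0) := if_pos h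

theorem slot_of_lt {u : Node m k S} {j : ℕ} (h : j < nodeDim u) :
    slot u j = (u.1.1, child j u.1.2) := if_neg (by omega)

theorem nodeDim_le (u : Node m k S) : nodeDim u ≤ u.1.1 := rootDim_le u.2.2.2.1

theorem nodeDim_lt (u : Node m k S) : nodeDim u < m := (nodeDim_le u).trans_lt u.2.2.1

/-- All vertices at position `j` are roots of binomial trees of the same dimension `j`. -/
theorem nodeDim_of_eq_slot {u x : Node m k S} {j : ℕ} (h : x.1 = slot u j) : nodeDim x = j := by
  by_cases hj : nodeDim u ≤ j
  · rw [nodeDim, h, slot_of_le hj, rootDim_zero]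
  · rw [nodeDim, h, slot_of_lt (by omega)]
    exact rootDim_child u.2.2.2.1 (by simpa [nodeDim] using hj)

theorem slot_inj {u : Node m k S} {i j : ℕ} {x : Node m k S} (hi : x.1 = slot u i)
    (hj : x.1 = slot u j) : i = j := by
  rw [← nodeDim_of_eq_slot hi, nodeDim_of_eq_slot hj]

open Classical in
/-- The vertex given by a pair of numbers, unless this pair is not a vertex or is `u`. -/
noncomputable def toNodeNe (u : Node m k S) (p : ℕ × ℕ) : Option (Node m k S) :=
  if h : IsNode m k S p ∧ p ≠ u.1 then some ⟨p, h.1⟩ else none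

theorem toNodeNe_eq_some {u x : Node m k S} {p : ℕ × ℕ} :
    toNodeNe u p = some x ↔ x.1 = p ∧ x ≠ u := by
  rw [toNodeNe]
  split_ifs with h
  · rw [Option.some_inj]
    constructor
    · rintro rfl
      exact ⟨rfl, fun h' => h.2 (congrArg Subtype.val h')⟩
    · rintro ⟨rfl, -⟩
      rfl
  · simp only [false_iff, not_and]
    rintro rfl hx
    exact h ⟨x.2, fun h' => hx (Subtype.ext h')⟩

theorem treeLists_eq (u : Node m k S) :
    treeLists m k S u = ((List.range m).reverse.map (slot u)).filterMap (toNodeNe u) := by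
  have hd := nodeDim_lt u
  have hm : List.range m =
      List.range (nodeDim u) ++ (List.range (m - nodeDim u)).map (nodeDim u + ·) := by
    rw [← List.range_add, Nat.add_sub_cancel' hd.le]
  have h1 : (List.range m).reverse.filter (fun j => decide (nodeDim u ≤ j)) =
      ((List.range (m - nodeDim u)).map (nodeDim u + ·)).reverse := by
    rw [hm, List.reverse_append, List.filter_append]
    rw [List.filter_eq_self.2, List.filter_eq_nil_iff.2, List.append_nil]
    · simp
    · simp only [List.mem_reverse, List.mem_map, decide_eq_true_eq]
      rintro _ ⟨a, -, rfl⟩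
      omega
  have h2 : (List.range m).reverse.map (slot u) =
      ((List.range m).reverse.filter (fun j => decide (nodeDim u ≤ j))).map (fun j => (j, 0)) ++
      (List.range (nodeDim u)).reverse.map (fun j => (u.1.1, child j u.1.2)) := by
    rw [h1, hm, List.reverse_append, List.map_append]
    congr 1
    · refine List.map_congr_left fun j hj => slot_of_le ?_
      simp only [List.mem_reverse, List.mem_map] at hj
      obtain ⟨a, -, rfl⟩ := hj
      omega
    · refine List.map_congr_left fun j hj => slot_of_lt ?_
      simpa using hj
  rw [h2]
  rfl

theorem mem_treeLists {u x : Node m k S} :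
    x ∈ treeLists m k S u ↔ x ≠ u ∧ ∃ j < m, x.1 = slot u j := by
  simp only [treeLists_eq, List.mem_filterMap, List.mem_map, List.mem_reverse, List.mem_range,
    toNodeNe_eq_some]
  constructor
  · rintro ⟨_, ⟨j, hj, rfl⟩, hx, hne⟩
    exact ⟨hne, j, hj, hx⟩
  · rintro ⟨hne, j, hj, hx⟩
    exact ⟨_, ⟨j, hj, rfl⟩, hx, hne⟩

theorem nodup_treeLists (u : Node m k S) : (treeLists m k S u).Nodup := by
  rw [treeLists_eq, List.filterMap_map]
  refine List.Nodup.filterMap (fun i j x hi hj => ?_) (List.nodup_reverse.2 List.nodup_range)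
  exact slot_inj (toNodeNe_eq_some.1 hi).1 (toNodeNe_eq_some.1 hj).1

theorem treeLists_split {u x : Node m k S} {j : ℕ} (hj : j < m) (hx : x.1 = slot u j)
    (hne : x ≠ u) : ∃ A B, treeLists m k S u = A ++ x :: B ∧
      ∀ y ∈ A, ∃ i, j < i ∧ i < m ∧ y.1 = slot u i := by
  have hm : List.range m =
      List.range j ++ [j] ++ (List.range (m - (j + 1))).map (j + 1 + ·) := by
    rw [← List.range_succ, ← List.range_add, Nat.add_sub_cancel' hj]
  refine ⟨(((List.range (m - (j + 1))).map (j + 1 + ·)).reverse.map (slot u)).filterMap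
    (toNodeNe u), ((List.range j).reverse.map (slot u)).filterMap (toNodeNe u), ?_, ?_⟩
  · have h : toNodeNe u (slot u j) = some x := toNodeNe_eq_some.2 ⟨hx, hne⟩
    rw [treeLists_eq, hm, List.reverse_append, List.reverse_append, List.map_append,
      List.map_append, List.filterMap_append, List.filterMap_append]
    simp [h]
  · intro y hy
    simp only [List.mem_filterMap, List.mem_map, List.mem_reverse, List.mem_range,
      toNodeNe_eq_some] at hy
    obtain ⟨_, ⟨_, ⟨a, ha, rfl⟩, rfl⟩, hy, -⟩ := hy
    exact ⟨j + 1 + a, by omega, by omega, hy⟩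

/-! ### Broadcast time -/

theorem mem_informed_slot {s u x : Node m k S} {t j : ℕ}
    (hu : u ∈ informed (treeLists m k S) s t) (hj : j < m) (hx : x.1 = slot u j)
    (h : ∀ i y, j < i → y.1 = slot u i → y ∈ informed (treeLists m k S) s t) :
    x ∈ informed (treeLists m k S) s (t + 1) := by
  by_cases hne : x = u
  · exact hne ▸ informed_mono _ s (Nat.le_succ t) hu
  · obtain ⟨A, B, hl, hA⟩ := treeLists_split hj hx hne
    refine mem_informed_succ hu hl fun y hy => ?_
    obtain ⟨i, hi, -, hy⟩ := hA y hy
    exact h i y hi hy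

/-- Every vertex that is not one of the roots `v_i` is a child of a vertex, which was not
removed. -/
theorem exists_parent (hS : IsSubtree k S) (u : Node m k S) (hu : u.1.2 ≠ 0) :
    ∃ p : Node m k S, p.1.1 = u.1.1 ∧ IsChild u.1.1 p.1.2 u.1.2 ∧ nodeDim u < nodeDim p ∧
      u.1 = slot p (nodeDim u) := by
  obtain ⟨⟨i, x⟩, hk, hm, hx, hxS⟩ := u
  obtain ⟨y, hy, hlt, hyx⟩ := exists_eq_child hx hu
  have hc : IsChild i y x := ⟨hy, _, hlt, hyx.symm⟩
  refine ⟨⟨(i, y), hk, hm, hy, fun h => ?_⟩, rfl, hc, hlt, ?_⟩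
  · obtain rfl : i = k := h
    exact hS.parent_mem y x hc (hxS rfl)
  · rw [slot_of_lt (by exact hlt)]
    exact congrArg (Prod.mk i) hyx.symm

/-- The vertex that, having the source as a child or being the source itself, is one round ahead of
the other vertices of its dimension, because it need not call the source. -/
theorem exists_early (hS : IsSubtree k S) (s : Node m k S) :
    ∃ p : Node m k S, p.1.1 = s.1.1 ∧ nodeDim s ≤ nodeDim p ∧ (p = s ∨ nodeDim s < nodeDim p) ∧
      s.1 = slot p (nodeDim s) := by
  by_cases h0 : s.1.2 = 0
  · refine ⟨s, rfl, le_rfl, Or.inl rfl, ?_⟩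
    rw [slot_of_le le_rfl, nodeDim, h0, rootDim_zero]
    exact Prod.ext rfl h0
  · obtain ⟨p, hp, -, hlt, hs⟩ := exists_parent hS s h0
    exact ⟨p, hp, hlt.le, Or.inr hlt, hs⟩

/-- The invariant of the broadcast: the root of a binomial tree of dimension `j` is informed after
`m - j` rounds, and already after `m - j - 1` rounds if it is a child of the vertex `p` that need
not call the source `s` and `j` is less than the dimension of `s`. The second part is what ensures
that the roots `v_j` that `s` itself calls too late are called in time. -/
theorem informed_invariant (hS : IsSubtree k S) {s p : Node m k S} (hps : p.1.1 = s.1.1)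
    (hdim : nodeDim s ≤ nodeDim p) (hp : p = s ∨ nodeDim s < nodeDim p)
    (hs : s.1 = slot p (nodeDim s)) (t : ℕ) :
    (∀ u, m ≤ t + nodeDim u → u ∈ informed (treeLists m k S) s t) ∧
    ∀ j ≤ nodeDim s, m ≤ t + j + 1 → ∀ x, x.1 = slot p j →
      x ∈ informed (treeLists m k S) s t := by
  have hsource := source_mem_informed (treeLists m k S) s
  have hself {t : ℕ} {x : Node m k S} (hx : x.1 = slot p (nodeDim s)) :
      x ∈ informed (treeLists m k S) s t := by
    obtain rfl : x = s := Subtype.ext (hx.trans hs.symm)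
    exact hsource t
  induction t with
  | zero =>
    refine ⟨fun u hu => absurd (nodeDim_lt u) (by omega), fun j hj hm x hx => ?_⟩
    obtain rfl : j = nodeDim s := by
      have := nodeDim_lt s
      omega
    exact hself hx
  | succ t ih =>
    obtain ⟨ihA, ihB⟩ := ih
    constructor
    · intro u hu
      by_cases hu' : m ≤ t + nodeDim u
      · exact informed_mono _ s (Nat.le_succ t) (ihA u hu')
      have hlt := nodeDim_lt u
      have hlarge : ∀ (w : Node m k S) i y, nodeDim u < i → y.1 = slot w i →
          y ∈ informed (treeLists m k S) s t := fun w i y hi hy =>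
        ihA y (by rw [nodeDim_of_eq_slot hy]; omega)
      by_cases h0 : u.1.2 = 0
      · have hroot : u.1 = (nodeDim u, 0) := by
          rw [nodeDim, h0, rootDim_zero]
          exact Prod.ext rfl h0
        -- `v_j` is called by the source or by the child of dimension `j` of the vertex `p`
        obtain ⟨w, hw, hwdim⟩ : ∃ w ∈ informed (treeLists m k S) s t, nodeDim w ≤ nodeDim u := by
          by_cases hsu : nodeDim s ≤ nodeDim u
          · exact ⟨s, hsource t, hsu⟩
          · have hslot : slot p (nodeDim u) = (p.1.1, child (nodeDim u) p.1.2) :=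
              slot_of_lt (by omega)
            have hnode : IsNode m k S (slot p (nodeDim u)) := by
              have h1 := nodeDim_le s
              have h2 := u.2.1
              rw [hroot] at h2
              rw [hslot]
              refine ⟨p.2.1, p.2.2.1, child_lt p.2.2.2.1 (by rw [← nodeDim]; omega), ?_⟩
              dsimp only at h2 ⊢
              omega
            exact ⟨⟨_, hnode⟩, ihB _ (by omega) (by omega) _ rfl, (nodeDim_of_eq_slot rfl).le⟩
        exact mem_informed_slot hw hlt (hroot.trans (slot_of_le hwdim).symm) (hlarge w)
      · obtain ⟨q, -, -, hq, huq⟩ := exists_parent hS u h0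
        exact mem_informed_slot (ihA q (by omega)) hlt huq (hlarge q)
    · intro j hj hm x hx
      rcases hj.eq_or_lt with rfl | hj
      · exact hself hx
      have hpt : p ∈ informed (treeLists m k S) s t := by
        rcases hp with rfl | hp
        · exact hsource t
        · exact ihA p (by omega)
      refine mem_informed_slot hpt (hj.trans (nodeDim_lt s)) hx fun i y hi hy => ?_
      by_cases his : i ≤ nodeDim s
      · exact ihB i his (by omega) y hy
      · exact ihA y (by rw [nodeDim_of_eq_slot hy]; omega)

theorem informed_treeLists (hS : IsSubtree k S) (s : Node m k S) :
    informed (treeLists m k S) s m = Set.univ := by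
  obtain ⟨p, hps, hdim, hp, hs⟩ := exists_early hS s
  exact Set.eq_univ_of_forall fun u =>
    (informed_invariant hS hps hdim hp hs m).1 u (Nat.le_add_right _ _)

theorem isLists_treeLists : IsLists (treeGraph m k S) (treeLists m k S) := by
  refine fun u => ⟨nodup_treeLists u, fun x hx => ?_⟩
  obtain ⟨hne, j, hj, hx⟩ := mem_treeLists.1 hx
  by_cases hd : nodeDim u ≤ j
  · rw [slot_of_le hd] at hx
    have hk : k ≤ j := by simpa [hx] using x.2.1
    refine Or.inr ?_
    simp only [SimpleGraph.iSup_adj]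
    exact ⟨j, Finset.mem_Ico.2 ⟨hk, hj⟩, hne.symm, Or.inr hx⟩
  · rw [slot_of_lt (by omega)] at hx
    refine Or.inl ⟨by rw [hx], binomialTree_adj.2 (Or.inl ⟨u.2.2.2.1, j, ?_, by rw [hx]⟩)⟩
    simpa [nodeDim] using hd

/-! ### Counting vertices and edges -/

/-- The root `v_i` of the tree `T_i`. -/
def rootNode (hS : IsSubtree k S) {i : ℕ} (hi : i ∈ Finset.Ico k m) : Node m k S :=
  ⟨(i, 0), (Finset.mem_Ico.1 hi).1, (Finset.mem_Ico.1 hi).2, by positivity, fun _ => hS.zero_mem⟩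

/-- The vertices of the trees as a finite set of pairs. -/
def nodePairs (m k : ℕ) (S : Finset ℕ) : Finset (Σ _ : ℕ, ℕ) :=
  (Finset.Ico k m).sigma fun i => if i = k then S else Finset.range (2 ^ i)

/-- The vertices of the trees correspond to the elements of `nodePairs m k S`. -/
def nodeEquiv (hS : IsSubtree k S) : Node m k S ≃ nodePairs m k S :=
  (Equiv.sigmaEquivProd ℕ ℕ).symm.subtypeEquiv fun p => by
    simp only [IsNode, nodePairs, Finset.mem_sigma, Finset.mem_Ico, Equiv.sigmaEquivProd_symm_apply]
    split_ifs with h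
    · exact ⟨fun ⟨h1, h2, _, h4⟩ => ⟨⟨h1, h2⟩, h4 h⟩,
        fun ⟨⟨h1, h2⟩, h4⟩ => ⟨h1, h2, h ▸ hS.lt h4, fun _ => h4⟩⟩
    · exact ⟨fun ⟨h1, h2, h3, _⟩ => ⟨⟨h1, h2⟩, Finset.mem_range.2 h3⟩,
        fun ⟨⟨h1, h2⟩, h3⟩ => ⟨h1, h2, Finset.mem_range.1 h3, fun h' => absurd h' h⟩⟩

theorem finite_node (hS : IsSubtree k S) : Finite (Node m k S) :=
  Finite.of_equiv _ (nodeEquiv hS).symm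

theorem card_node (hS : IsSubtree k S) (hkm : k < m) :
    Nat.card (Node m k S) + 2 ^ (k + 1) = S.card + 2 ^ m := by
  have hsum : ∑ i ∈ Finset.Ico (k + 1) m, (if i = k then S else Finset.range (2 ^ i)).card =
      ∑ i ∈ Finset.Ico (k + 1) m, 2 ^ i := Finset.sum_congr rfl fun i hi => by
    rw [if_neg (by have := (Finset.mem_Ico.1 hi).1; omega), Finset.card_range]
  have hgeom : ∑ i ∈ Finset.Ico (k + 1) m, 2 ^ i + 2 ^ (k + 1) = 2 ^ m := by
    obtain ⟨a, rfl⟩ := Nat.exists_eq_add_of_le (Nat.succ_le_of_lt hkm)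
    clear hsum
    induction a with
    | zero => simp
    | succ a ih =>
      rw [← add_assoc, Finset.sum_Ico_succ_top (by omega), pow_succ _ (k.succ + a)]
      have := ih (by omega)
      omega
  rw [Nat.card_congr (nodeEquiv hS), Nat.card_eq_fintype_card, Fintype.card_coe, nodePairs,
    Finset.card_sigma, Finset.sum_eq_sum_Ico_succ_bot hkm, if_pos rfl, hsum]
  omega

/-- The edges of the trees correspond to the vertices other than the roots: every such vertex is
joined to its parent. -/
theorem ncard_edgeSet_forest (hS : IsSubtree k S) :
    (forest m k S).edgeSet.ncard + (m - k) = Nat.card (Node m k S) := by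
  have := finite_node (m := m) hS
  choose! parent h1 h2 _ _ using exists_parent (m := m) hS
  have hlt (u : Node m k S) (hu : u.1.2 ≠ 0) : (parent u).1.2 < u.1.2 := (h2 u hu).lt
  have hedge : (forest m k S).edgeSet =
      (fun u => s(u, parent u)) '' {u : Node m k S | u.1.2 ≠ 0} := by
    have key {u p : Node m k S} (hpu : p.1.1 = u.1.1) (hc : IsChild u.1.1 p.1.2 u.1.2) :
        u.1.2 ≠ 0 ∧ parent u = p := by
      have hu : u.1.2 ≠ 0 := by
        have := hc.lt
        omega
      exact ⟨hu, Subtype.ext (Prod.ext ((h1 u hu).trans hpu.symm) ((h2 u hu).eq hc))⟩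
    ext e
    induction e with
    | _ p q =>
    constructor
    · rintro ⟨hpq, hadj⟩
      rcases binomialTree_adj.1 hadj with hc | hc
      · obtain ⟨hq, h⟩ := key hpq (by rwa [← hpq])
        exact ⟨q, hq, by simp only [h]; exact Sym2.eq_swap⟩
      · obtain ⟨hp, h⟩ := key hpq.symm hc
        exact ⟨p, hp, by simp only [h]⟩
    · rintro ⟨u, hu, h⟩
      rw [← h, SimpleGraph.mem_edgeSet]
      exact ⟨(h1 u hu).symm, binomialTree_adj.2 (Or.inr (h2 u hu))⟩
  have hinj : Set.InjOn (fun u => s(u, parent u)) {u : Node m k S | u.1.2 ≠ 0} := by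
    intro u hu w hw h
    rcases Sym2.eq_iff.1 h with ⟨h, -⟩ | ⟨h, h'⟩
    · exact h
    · have h3 := hlt u hu
      have h4 := hlt w hw
      rw [h'] at h3
      rw [← h] at h4
      omega
  have hroots : {u : Node m k S | u.1.2 ≠ 0}ᶜ.ncard = m - k := by
    rw [← Nat.card_Ico k m, ← Set.ncard_coe_finset]
    refine Set.ncard_congr (fun u _ => u.1.1) (fun u _ => by simpa using ⟨u.2.1, u.2.2.1⟩)
      (fun u w hu hw h => ?_) fun i hi => ?_
    · have hu : u.1.2 = 0 := not_not.1 hu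
      have hw : w.1.2 = 0 := not_not.1 hw
      exact Subtype.ext (Prod.ext h (hu.trans hw.symm))
    · exact ⟨rootNode hS hi, not_not.2 rfl, rfl⟩
  rw [hedge, hinj.ncard_image, ← hroots, Set.ncard_add_ncard_compl]

theorem ncard_edgeSet_rootEdges (hS : IsSubtree k S) {i : ℕ} (hi : i ∈ Finset.Ico k m) :
    (rootEdges m k S i).edgeSet.ncard + 1 = Nat.card (Node m k S) := by
  have := finite_node (m := m) hS
  set v := rootNode hS hi with hv
  have heq {u : Node m k S} : u.1 = (i, 0) ↔ u = v := by
    rw [Subtype.ext_iff]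
    rfl
  have hedge : (rootEdges m k S i).edgeSet = (fun u => s(v, u)) '' {v}ᶜ := by
    ext e
    induction e with
    | _ p q =>
    constructor
    · rintro ⟨hne, h | h⟩
      · obtain rfl := heq.1 h
        exact ⟨q, hne.symm, rfl⟩
      · obtain rfl := heq.1 h
        exact ⟨p, hne, Sym2.eq_swap⟩
    · rintro ⟨u, hu, h⟩
      rw [← h, SimpleGraph.mem_edgeSet]
      exact ⟨fun h => hu h.symm, Or.inl rfl⟩
  have hinj : Function.Injective fun u => s(v, u) := fun _ _ => Sym2.congr_right.1
  rw [hedge, Set.ncard_image_of_injective _ hinj, ← Set.ncard_singleton v, add_comm,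
    Set.ncard_add_ncard_compl]

theorem ncard_edgeSet_forest_add (hS : IsSubtree k S) :
    (forest m k S).edgeSet.ncard + ∑ i ∈ Finset.Ico k m, (rootEdges m k S i).edgeSet.ncard +
      2 * (m - k) = (m - k + 1) * Nat.card (Node m k S) := by
  have h : ∑ i ∈ Finset.Ico k m, (rootEdges m k S i).edgeSet.ncard + (m - k) =
      (m - k) * Nat.card (Node m k S) := by
    have := Finset.sum_congr rfl fun i (hi : i ∈ Finset.Ico k m) => ncard_edgeSet_rootEdges hS hi
    simpa [Finset.sum_add_distrib] using this
  have := ncard_edgeSet_forest (m := m) hS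
  rw [add_mul, one_mul]
  omega

theorem ncard_edgeSet_treeGraph_le (hS : IsSubtree k S) :
    (treeGraph m k S).edgeSet.ncard ≤ (forest m k S).edgeSet.ncard +
      ∑ i ∈ Finset.Ico k m, (rootEdges m k S i).edgeSet.ncard := by
  have := finite_node (m := m) hS
  have hsub : (treeGraph m k S).edgeSet ⊆
      (forest m k S).edgeSet ∪ ⋃ i ∈ Finset.Ico k m, (rootEdges m k S i).edgeSet := by
    rintro ⟨p, q⟩ (h | h)
    · exact Or.inl h
    · simp only [SimpleGraph.iSup_adj] at h
      obtain ⟨i, hi, h⟩ := h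
      exact Or.inr (Set.mem_biUnion hi h)
  refine (Set.ncard_le_ncard hsub (Set.toFinite _)).trans ((Set.ncard_union_le _ _).trans ?_)
  exact Nat.add_le_add_left (Finset.set_ncard_biUnion_le _ _) _

end Graph

end SourceOblivious

open SourceOblivious
theorem theorem2 :
    -- every `n ≥ 1` admits a broadcast graph with `O(n * L(n))` edges
    (∃ C : ℕ, ∀ n : ℕ, 1 ≤ n → ∃ G : SimpleGraph (Fin n),
      IsBroadcastGraph G ∧ G.edgeSet.ncard ≤ C * (n * leadingOnes n)) ∧
    -- every `n` that is not a power of two has the form `2 ^ m - 2 ^ k - r`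
    (∀ n : ℕ, 1 ≤ n → (∀ d : ℕ, n ≠ 2 ^ d) →
      ∃ m k r : ℕ, k + 2 ≤ m ∧ r < 2 ^ k ∧ n + 2 ^ k + r = 2 ^ m) ∧
    -- for such `n`, the value of `L(n)`, the explicit graph and the explicit lists
    (∀ n m k r : ℕ, k + 2 ≤ m → r < 2 ^ k → n + 2 ^ k + r = 2 ^ m →
      leadingOnes n + k + 1 = m ∧
      (∃ S : Finset ℕ, Pruned k r S) ∧
      ∀ S : Finset ℕ, Pruned k r S →
        Nat.card (Node m k S) = n ∧
        -- the number of edges, when each tree and each root contributes its own edges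
        (forest m k S).edgeSet.ncard + ∑ i ∈ Finset.Ico k m, (rootEdges m k S i).edgeSet.ncard
          + 2 * (m - k) = (m - k + 1) * n ∧
        -- the number of edges of the simple graph
        (treeGraph m k S).edgeSet.ncard + 2 * (m - k) ≤ (m - k + 1) * n ∧
        IsLists (treeGraph m k S) (treeLists m k S) ∧
        (∀ s : Node m k S, rounds (treeLists m k S) s = (Nat.clog 2 n : ℕ∞)) ∧
        IsBroadcastGraph (treeGraph m k S)) := by
  have hcard {n m k r : ℕ} {S : Finset ℕ} (hk : k + 2 ≤ m) (hr : r < 2 ^ k)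
      (h : n + 2 ^ k + r = 2 ^ m) (hS : Pruned k r S) : Nat.card (Node m k S) = n := by
    have h1 := (hS.isSubtree hr).2
    have h2 := card_node (m := m) (hS.isSubtree hr).1 (by omega)
    rw [pow_succ] at h2
    omega
  have hinf {n m k r : ℕ} {S : Finset ℕ} (hk : k + 2 ≤ m) (hr : r < 2 ^ k)
      (h : n + 2 ^ k + r = 2 ^ m) (hS : Pruned k r S) (s : Node m k S) :
      informed (treeLists m k S) s (Nat.clog 2 (Nat.card (Node m k S))) = Set.univ := by
    rw [hcard hk hr h hS, clog_of_representation hk hr h]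
    exact informed_treeLists (hS.isSubtree hr).1 s
  have hne {m k r : ℕ} {S : Finset ℕ} (hk : k + 2 ≤ m) (hr : r < 2 ^ k) (hS : Pruned k r S) :
      Nonempty (Node m k S) :=
    ⟨rootNode (hS.isSubtree hr).1 (Finset.left_mem_Ico.2 (by omega))⟩
  have hedges {n m k r : ℕ} {S : Finset ℕ} (hk : k + 2 ≤ m) (hr : r < 2 ^ k)
      (h : n + 2 ^ k + r = 2 ^ m) (hS : Pruned k r S) :
      (forest m k S).edgeSet.ncard + ∑ i ∈ Finset.Ico k m, (rootEdges m k S i).edgeSet.ncard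
          + 2 * (m - k) = (m - k + 1) * n := by
    rw [ncard_edgeSet_forest_add (hS.isSubtree hr).1, hcard hk hr h hS]
  have hle {n m k r : ℕ} {S : Finset ℕ} (hk : k + 2 ≤ m) (hr : r < 2 ^ k)
      (h : n + 2 ^ k + r = 2 ^ m) (hS : Pruned k r S) :
      (treeGraph m k S).edgeSet.ncard + 2 * (m - k) ≤ (m - k + 1) * n :=
    (Nat.add_le_add_right (ncard_edgeSet_treeGraph_le (hS.isSubtree hr).1) _).trans_eq
      (hedges hk hr h hS)
  refine ⟨⟨3, fun n hn => ?_⟩, fun n => exists_two_pow_representation,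
    fun n m k r hk hr h => ⟨leadingOnes_add hk hr h, exists_pruned hr, fun S hS => ?_⟩⟩
  · by_cases h2 : ∃ d, n = 2 ^ d
    · obtain ⟨d, rfl⟩ := h2
      obtain ⟨G, hG, hE⟩ := exists_isBroadcastGraph_two_pow d
      refine ⟨G, hG, hE.trans ?_⟩
      rw [leadingOnes_two_pow]
      omega
    · obtain ⟨m, k, r, hk, hr, h⟩ := exists_two_pow_representation hn (not_exists.1 h2)
      obtain ⟨S, hS⟩ := exists_pruned hr
      have := finite_node (m := m) (hS.isSubtree hr).1
      have := hne hk hr hS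
      obtain ⟨G, hG, hE⟩ := exists_isBroadcastGraph_fin isLists_treeLists (hinf hk hr h hS)
        (hcard hk hr h hS)
      refine ⟨G, hG, hE.trans_le ?_⟩
      have hL := leadingOnes_add hk hr h
      -- the factor `m - k + 1` equals `L(n) + 2`, which is at most `3 * L(n)` as `L(n) ≥ 1`
      calc (treeGraph m k S).edgeSet.ncard ≤ (m - k + 1) * n := by
            have := hle hk hr h hS
            omega
        _ ≤ 3 * leadingOnes n * n := Nat.mul_le_mul_right n (by omega)
        _ = 3 * (n * leadingOnes n) := by ring
  · have := finite_node (m := m) (hS.isSubtree hr).1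
    have := hne hk hr hS
    refine ⟨hcard hk hr h hS, hedges hk hr h hS, hle hk hr h hS, isLists_treeLists, fun s => ?_,
      isBroadcastGraph_of_lists isLists_treeLists (hinf hk hr h hS)⟩
    rw [rounds_eq_clog (hinf hk hr h hS s), hcard hk hr h hS]
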